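/- Let $D\ge 1$ be the number of classes, $M\ge 2$ the number of hidden units, $N\ge 1$ the number of training samples, and let $\rho:\mathbb{R}\to[0,\infty)$ be $L_\rho$-Lipschitz. Let $\mathcal{X}\subseteq\mathbb{R}^p$ be a set of inputs with $\|x\|_2\le C_1$ for all $x\in\mathcal{X}$, and let $\mathcal{Q}$ be a probability distribution of pairs $(x,y)$ with $x\in\mathcal{X}$ almost surely and $y\in\{1,\dots,D\}$. Let $\mathcal{F}$ be the class of all one-hidden-layer networks $f=(f_1,\dots,f_D)$, $$f_k(x)=\sum_{m=1}^M v_{k,m}\,\phi_m(x),\qquad \phi_m(x)=\rho(w_m^{T}x),$$ with $\|w_m\|_2\le C_3$ for all $m$, $\|v_k\|_\infty\le C_4$ for all $k$, and $$\frac{1}{2M(M-1)}\sum_{n\ne m}\big(\phi_n(x)-\phi_m(x)\big)^2\ \ge\ d_{min}^2\qquad\text{for every }x\in\mathcal{X},$$ where the sum is over ordered pairs. Let $l(f(x),y)=-\log\frac{e^{f_y(x)}}{\sum_{j=1}^D e^{f_j(x)}}$ be the cross-entropy loss, $L(f)=\mathbb{E}_{(x,y)\sim\mathcal{Q}}[l(f(x),y)]$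 the expected risk and $\hat L(f)=\frac1N\sum_{i=1}^N l(f(x_i),y_i)$ the empirical risk on an i.i.d. sample $(x_i,y_i)_{i\le N}$ from $\mathcal{Q}$. Let $f^*$ be a minimizer of $L$ over $\mathcal{F}$ and let $0<\delta<1$. Then, with probability at least $1-\delta$ over the sample, every minimizer $\hat f$ of $\hat L$ over $\mathcal{F}$ satisfies $$L(\hat f)-L(f^*)\ \le\ \frac{A}{\big(D-1+e^{-2\sqrt{\mathcal{J}}}\big)\sqrt N}+\log\!\Big(1+(D-1)e^{2\sqrt{\mathcal{J}}}\Big)\sqrt{\frac{2\log(2/\delta)}{N}},$$ where $C_5=L_\rho C_1C_3+\rho(0)$, $\mathcal{J}=C_4^2\big(MC_5^2+M(M-1)(C_5^2-d_{min}^2)\big)$ and $A=4D(D-1)\big(2L_\rho C_1C_3C_4+C_4|\rho(0)|\big)M$. -/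

import Mathlib

open MeasureTheory
open scoped NNReal

noncomputable section

namespace DiverseNet

/-- The features `φ_m(x) = ρ(w_mᵀ x)`, `m = 1, …, M`, of the hidden layer. -/
def features {p M : ℕ} (ρ : ℝ → ℝ) (W : Fin M → EuclideanSpace ℝ (Fin p))
    (x : EuclideanSpace ℝ (Fin p)) (m : Fin M) : ℝ :=
  ρ (inner ℝ (W m) x)

/-- The average pairwise squared distance `1 / (2M(M-1)) ∑_{i ≠ j} (φ_i - φ_j)²`,
the sum being over ordered pairs. -/
def diversity {M : ℕ} (φ : Fin M → ℝ) : ℝ :=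
  1 / (2 * (M : ℝ) * ((M : ℝ) - 1)) *
    ∑ i : Fin M, ∑ j ∈ Finset.univ.filter (fun j : Fin M => i ≠ j), (φ i - φ j) ^ 2

/-- The one-hidden-layer network with `D` outputs,
`f(x)_k = ∑_m v_{k,m} ρ(w_mᵀ x)`; all outputs share the hidden layer. -/
def network {p M D : ℕ} (ρ : ℝ → ℝ) (W : Fin M → EuclideanSpace ℝ (Fin p))
    (V : Fin D → Fin M → ℝ) (x : EuclideanSpace ℝ (Fin p)) (k : Fin D) : ℝ :=
  ∑ m : Fin M, V k m * features ρ W x m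

/-- The networks with `‖w_m‖₂ ≤ C₃`, `‖v_k‖_∞ ≤ C₄` (the norm of `Fin M → ℝ` is the sup norm),
whose features have diversity at least `dmin²` at every input `x ∈ 𝒳`. -/
def hypothesisClass {p : ℕ} (M D : ℕ) (ρ : ℝ → ℝ) (𝒳 : Set (EuclideanSpace ℝ (Fin p)))
    (C₃ C₄ dmin : ℝ) : Set (EuclideanSpace ℝ (Fin p) → Fin D → ℝ) :=
  {f | ∃ (W : Fin M → EuclideanSpace ℝ (Fin p)) (V : Fin D → Fin M → ℝ),
      (∀ m, ‖W m‖ ≤ C₃) ∧ (∀ k, ‖V k‖ ≤ C₄) ∧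
      (∀ x ∈ 𝒳, dmin ^ 2 ≤ diversity (features ρ W x)) ∧
      f = network ρ W V}

/-- The softmax probabilities of a vector of logits. -/
def softmax {D : ℕ} (z : Fin D → ℝ) (k : Fin D) : ℝ :=
  Real.exp (z k) / ∑ j : Fin D, Real.exp (z j)

/-- The cross-entropy loss of the logits `z` for the class `y`. -/
def crossEntropyLoss {D : ℕ} (z : Fin D → ℝ) (y : Fin D) : ℝ :=
  -Real.log (softmax z y)

/-- The expected risk `L(f) = E_{(x,y) ∼ Q} l(f(x), y)`. -/
def risk {p D : ℕ} (Q : Measure (EuclideanSpace ℝ (Fin p) × Fin D))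
    (f : EuclideanSpace ℝ (Fin p) → Fin D → ℝ) : ℝ :=
  ∫ z, crossEntropyLoss (f z.1) z.2 ∂Q

/-- The empirical risk `L̂(f) = (1/N) ∑ᵢ l(f(xᵢ), yᵢ)` on the sample `S`. -/
def empiricalRisk {p D N : ℕ} (S : Fin N → EuclideanSpace ℝ (Fin p) × Fin D)
    (f : EuclideanSpace ℝ (Fin p) → Fin D → ℝ) : ℝ :=
  1 / (N : ℝ) * ∑ i : Fin N, crossEntropyLoss (f (S i).1) (S i).2

/-- `f` is a minimizer of `R` over the class `F`. -/
def IsMinimizer {α : Type*} (R : α → ℝ) (F : Set α) (f : α) : Prop :=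
  f ∈ F ∧ ∀ g ∈ F, R f ≤ R g

/-- `C₅ = L_ρ C₁ C₃ + ρ(0)`. -/
def const5 (ρ : ℝ → ℝ) (Lρ C₁ C₃ : ℝ) : ℝ :=
  Lρ * C₁ * C₃ + ρ 0

/-- `𝒥 = C₄² (M C₅² + M(M-1) (C₅² - dmin²))`. -/
def constJ (ρ : ℝ → ℝ) (Lρ C₁ C₃ C₄ dmin : ℝ) (M : ℕ) : ℝ :=
  C₄ ^ 2 * ((M : ℝ) * const5 ρ Lρ C₁ C₃ ^ 2 +
    (M : ℝ) * ((M : ℝ) - 1) * (const5 ρ Lρ C₁ C₃ ^ 2 - dmin ^ 2))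

/-- `A = 4 D (D-1) (2 L_ρ C₁ C₃ C₄ + C₄ |ρ(0)|) M`. -/
def constA (ρ : ℝ → ℝ) (Lρ C₁ C₃ C₄ : ℝ) (M D : ℕ) : ℝ :=
  4 * (D : ℝ) * ((D : ℝ) - 1) * (2 * Lρ * (C₁ * C₃ * C₄) + C₄ * |ρ 0|) * (M : ℝ)

end DiverseNet

end

open scoped BigOperators

namespace DiverseNet

/-! Since `fhat` has empirical risk at most that of `fstar`, its excess risk is at most gap(fhat) -
gap(fstar), where the gap is expected minus empirical risk. It suffices to bound this difference
uniformly over the class. The diversity condition bounds the sum of the features, hence every logit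
by `√constJ` (`abs_network_le`). On that cube the loss is bounded by the logarithm in the statement
and is Lipschitz in the sup norm (`exists_abs_crossEntropyLoss_sub_le`). The mean of the largest gap
is at most twice a Rademacher average over N (`integral_maxOver_deviation_le`). A sup-norm vector
contraction without loss of constant (`contraction`) removes the loss, linearity in the output
weights leaves single neurons, and scalar contraction with orthogonality of signs bounds these by a
multiple of `√N`; this gives the `constA` term. The fluctuation around the mean is controlled by
McDiarmid's inequality (`integral_exp_le_of_boundedDifferences`). The gap of the competitor has mean
zero, so it can be subtracted beforehand and a single one-sided tail suffices. Suprema are taken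
over finite families, then over a dense sequence of weights by continuity from above, and finally
over all weights by continuity of the gap. -/

/-- The maximum of a real function on a nonempty finite type. -/
noncomputable def maxOver {T : Type*} [Fintype T] [Nonempty T] (g : T → ℝ) : ℝ :=
  Finset.univ.sup' Finset.univ_nonempty g

/-! ### Maxima of finite families -/

section Max

variable {T : Type*} [Fintype T] [Nonempty T]

lemma le_maxOver (g : T → ℝ) (t : T) : g t ≤ maxOver g :=
  Finset.le_sup' g (Finset.mem_univ t)

lemma maxOver_le {g : T → ℝ} {a : ℝ} (h : ∀ t, g t ≤ a) : maxOver g ≤ a :=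
  Finset.sup'_le _ _ fun t _ => h t

lemma exists_eq_maxOver (g : T → ℝ) : ∃ t, maxOver g = g t := by
  obtain ⟨t, -, ht⟩ := Finset.exists_mem_eq_sup' (Finset.univ_nonempty (α := T)) g
  exact ⟨t, ht⟩

lemma maxOver_mono {g h : T → ℝ} (H : ∀ t, g t ≤ h t) : maxOver g ≤ maxOver h :=
  maxOver_le fun t => (H t).trans (le_maxOver h t)

lemma maxOver_add_le (g h : T → ℝ) : maxOver (fun t => g t + h t) ≤ maxOver g + maxOver h :=
  maxOver_le fun t => add_le_add (le_maxOver g t) (le_maxOver h t)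

lemma abs_maxOver_sub_le {g h : T → ℝ} {c : ℝ} (H : ∀ t, |g t - h t| ≤ c) :
    |maxOver g - maxOver h| ≤ c := by
  rw [abs_sub_le_iff]
  constructor
  · rw [sub_le_iff_le_add]
    exact maxOver_le fun t => by
      linarith [(abs_le.1 (H t)).2, le_maxOver h t]
  · rw [sub_le_iff_le_add]
    exact maxOver_le fun t => by
      linarith [(abs_le.1 (H t)).1, le_maxOver g t]

lemma measurable_maxOver {Z : Type*} [MeasurableSpace Z] {f : T → Z → ℝ}
    (hf : ∀ t, Measurable (f t)) : Measurable fun z => maxOver fun t => f t z := by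
  have := Finset.measurable_sup' (Finset.univ_nonempty (α := T)) (f := f) fun t _ => hf t
  convert this using 1
  ext z
  simp [maxOver, Finset.sup'_apply]

end Max

/-! ### Averages over uniform random signs -/

/-- The sign `±1` encoded by a Boolean. -/
def sgn (b : Bool) : ℝ := if b then 1 else -1

lemma sgn_not (b : Bool) : sgn (!b) = -sgn b := by cases b <;> simp [sgn]

lemma sgn_mul_self (b : Bool) : sgn b * sgn b = 1 := by cases b <;> simp [sgn]

lemma expect_bool (F : Bool → ℝ) : 𝔼 b, F b = (F true + F false) / 2 := by
  rw [Fintype.expect_eq_sum_div_card]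
  simp

lemma expect_cons {α : Type*} [Fintype α] {n : ℕ} (F : (Fin (n + 1) → α) → ℝ) :
    𝔼 s, F s = 𝔼 a : α, 𝔼 s : Fin n → α, F (Fin.cons a s) := by
  rw [← Finset.expect_product', Finset.univ_product_univ]
  exact (Fintype.expect_equiv (Fin.consEquiv fun _ => α) _ _ fun _ => rfl).symm

lemma expect_eval {K α : Type*} [Fintype K] [DecidableEq K] [Fintype α] [Nonempty α] (k : K)
    (F : α → ℝ) : 𝔼 u : K → α, F (u k) = 𝔼 a, F a := by
  rw [Fintype.expect_equiv (Equiv.funSplitAt k α) (fun u => F (u k)) (fun p => F p.1)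
    fun u => rfl, ← Finset.univ_product_univ, Finset.expect_product]
  exact Finset.expect_congr rfl fun a _ =>
    Fintype.expect_const (ι := { j : K // j ≠ k } → α) (F a)

/-- With one sign per pair (sample, output), each output sees only its own column of signs, which is
again uniform. -/
lemma expect_eval_right {ι K α : Type*} [Fintype ι] [DecidableEq ι] [Fintype K] [DecidableEq K]
    [Fintype α] [Nonempty α] (k : K) (F : (ι → α) → ℝ) :
    𝔼 u : ι → K → α, F (fun i => u i k) = 𝔼 s, F s := by
  rw [← expect_eval k F]
  exact Fintype.expect_equiv (Equiv.piComm fun _ _ => α) _ _ fun _ => rfl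

lemma expect_nonneg' {α : Type*} [Fintype α] {F : α → ℝ} (h : ∀ a, 0 ≤ F a) : 0 ≤ 𝔼 a, F a :=
  Finset.expect_nonneg fun a _ => h a

lemma expect_mono {α : Type*} [Fintype α] {F G : α → ℝ} (h : ∀ a, F a ≤ G a) :
    𝔼 a, F a ≤ 𝔼 a, G a :=
  Finset.expect_le_expect fun a _ => h a

section Signs

variable {ι : Type*} [Fintype ι] [DecidableEq ι]

/-- Flipping one sign of a sign pattern. -/
def flipSign (j : ι) : (ι → Bool) ≃ (ι → Bool) :=
  Function.Involutive.toPerm (fun s => Function.update s j (!s j)) fun s => by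
    ext i
    by_cases h : i = j
    · subst h; simp
    · simp [h]

lemma expect_sgn_mul_of_ne {j k : ι} (h : j ≠ k) :
    𝔼 s : ι → Bool, sgn (s j) * sgn (s k) = 0 := by
  have := Fintype.expect_equiv (flipSign j) (fun s => sgn (s j) * sgn (s k))
    (fun s => -(sgn (s j) * sgn (s k))) fun s => by
      simp [flipSign, Function.Involutive.toPerm, sgn_not, h.symm]
  rw [Finset.expect_neg_distrib] at this
  linarith

lemma expect_sgn (j : ι) : 𝔼 s : ι → Bool, sgn (s j) = 0 := by
  rw [expect_eval j sgn, expect_bool]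
  simp [sgn]

lemma expect_sgn_mul (j k : ι) :
    𝔼 s : ι → Bool, sgn (s j) * sgn (s k) = if j = k then 1 else 0 := by
  split_ifs with h
  · subst h
    simp [sgn_mul_self]
  · exact expect_sgn_mul_of_ne h

lemma expect_sgn_mul_sum (k : ι) (c : ι → ℝ) :
    𝔼 s : ι → Bool, sgn (s k) * ∑ j, sgn (s j) * c j = c k := by
  simp_rw [Finset.mul_sum, ← mul_assoc]
  rw [Finset.expect_sum_comm]
  simp_rw [← Finset.expect_mul, expect_sgn_mul]
  simp

lemma expect_sum_sgn (c : ι → ℝ) : 𝔼 s : ι → Bool, ∑ j, sgn (s j) * c j = 0 := by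
  rw [Finset.expect_sum_comm]
  simp_rw [← Finset.expect_mul, expect_sgn]
  simp

lemma expect_norm_sq_sum_sgn {E : Type*} [NormedAddCommGroup E] [InnerProductSpace ℝ E]
    (x : ι → E) : 𝔼 s : ι → Bool, ‖∑ i, sgn (s i) • x i‖ ^ 2 = ∑ i, ‖x i‖ ^ 2 := by
  have : ∀ s : ι → Bool, ‖∑ i, sgn (s i) • x i‖ ^ 2 =
      ∑ i, ∑ j, (sgn (s i) * sgn (s j)) * inner ℝ (x i) (x j) := fun s => by
    rw [← real_inner_self_eq_norm_sq, sum_inner]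
    simp_rw [inner_sum, real_inner_smul_left, real_inner_smul_right, mul_assoc]
  simp_rw [this]
  rw [Finset.expect_sum_comm]
  refine Finset.sum_congr rfl fun i _ => ?_
  rw [Finset.expect_sum_comm]
  simp_rw [← Finset.expect_mul, expect_sgn_mul]
  simp

lemma expect_le_sqrt {α : Type*} [Fintype α] [Nonempty α] (F : α → ℝ) :
    𝔼 a, F a ≤ √(𝔼 a, F a ^ 2) := by
  apply Real.le_sqrt_of_sq_le
  set m := 𝔼 a, F a
  have h : 0 ≤ 𝔼 a, (F a - m) ^ 2 := expect_nonneg' fun a => sq_nonneg _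
  have e : 𝔼 a, (F a - m) ^ 2 = 𝔼 a, F a ^ 2 - m * 2 * m + m ^ 2 := by
    have : ∀ a, (F a - m) ^ 2 = F a ^ 2 - m * 2 * F a + m ^ 2 := fun a => by ring
    simp_rw [this]
    rw [Finset.expect_add_distrib, Finset.expect_sub_distrib, ← Finset.mul_expect,
      Fintype.expect_const]
  nlinarith

/-- Jensen reduces to the second moment, where independent signs kill the cross terms. -/
lemma expect_norm_sum_sgn_le {E : Type*} [NormedAddCommGroup E] [InnerProductSpace ℝ E]
    (x : ι → E) {C : ℝ} (hC : 0 ≤ C) (hx : ∀ i, ‖x i‖ ≤ C) :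
    𝔼 s : ι → Bool, ‖∑ i, sgn (s i) • x i‖ ≤ C * √(Fintype.card ι) := by
  refine (expect_le_sqrt _).trans ?_
  rw [expect_norm_sq_sum_sgn]
  apply Real.sqrt_le_iff.2
  refine ⟨by positivity, ?_⟩
  rw [mul_pow, Real.sq_sqrt (by positivity)]
  calc ∑ i, ‖x i‖ ^ 2 ≤ ∑ _i : ι, C ^ 2 :=
        Finset.sum_le_sum fun i _ => pow_le_pow_left₀ (norm_nonneg _) (hx i) 2
    _ = C ^ 2 * Fintype.card ι := by simp [mul_comm]

end Signs

/-! ### Vector contraction for the sup norm -/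

section Contraction

variable {T K : Type*} [Fintype T] [Nonempty T] [Fintype K] [DecidableEq K]

/-- Test the maximum at `t` when `u k` is true and at `t'` when it is false. The choice is
independent of the signs other than `u k`, so their terms average to zero and only coordinate `k`
survives. -/
lemma le_expect_maxOver_signs (g : T → ℝ) (f : K → T → ℝ) (k : K) (t t' : T) :
    ((g t + f k t) + (g t' - f k t')) / 2 ≤
      𝔼 u : K → Bool, maxOver fun t => g t + ∑ j, sgn (u j) * f j t := by
  have h : 𝔼 u : K → Bool, ((g t + g t') / 2 + sgn (u k) * ((g t - g t') / 2) +
      (∑ j, sgn (u j) * ((f j t + f j t') / 2) +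
        sgn (u k) * ∑ j, sgn (u j) * ((f j t - f j t') / 2))) =
      ((g t + f k t) + (g t' - f k t')) / 2 := by
    rw [Finset.expect_add_distrib, Finset.expect_add_distrib, Finset.expect_add_distrib,
      ← Finset.expect_mul, expect_sgn, expect_sgn_mul_sum, expect_sum_sgn, Fintype.expect_const]
    ring
  rw [← h]
  refine expect_mono fun u => ?_
  have e : ∀ c : ℝ, ∑ j, sgn (u j) * ((f j t + c * f j t') / 2) =
      (∑ j, sgn (u j) * f j t + c * ∑ j, sgn (u j) * f j t') / 2 := fun c => by
    rw [Finset.mul_sum, ← Finset.sum_add_distrib, Finset.sum_div]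
    exact Finset.sum_congr rfl fun j _ => by ring
  have e1 := e 1
  have e2 := e (-1)
  simp only [one_mul, neg_mul, ← sub_eq_add_neg] at e1 e2
  rw [e1, e2]
  have ht := le_maxOver (fun t => g t + ∑ j, sgn (u j) * f j t) t
  have ht' := le_maxOver (fun t => g t + ∑ j, sgn (u j) * f j t) t'
  cases hu : u k
  · simp only [sgn]
    refine le_trans (le_of_eq ?_) ht'
    simp only [sgn, Bool.false_eq_true, if_false]
    ring
  · simp only [sgn]
    refine le_trans (le_of_eq ?_) ht
    simp only [sgn, if_true]
    ring

/-- The left side is attained at a pair `t`, `t'`, and the hypothesis supplies a single coordinate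
dominating the increment of `h` for this pair; if its increment is negative, `t` and `t'` trade
roles. -/
lemma contraction_step (g h : T → ℝ) (f : K → T → ℝ)
    (H : ∀ t t', ∃ k, |h t - h t'| ≤ |f k t - f k t'|) :
    𝔼 b, maxOver (fun t => g t + sgn b * h t) ≤
      𝔼 u : K → Bool, maxOver fun t => g t + ∑ j, sgn (u j) * f j t := by
  rw [expect_bool]
  obtain ⟨t, ht⟩ := exists_eq_maxOver fun t => g t + sgn true * h t
  obtain ⟨t', ht'⟩ := exists_eq_maxOver fun t => g t + sgn false * h t
  obtain ⟨k, hk⟩ := H t t'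
  have e1 : sgn true = 1 := rfl
  have e2 : sgn false = -1 := rfl
  rw [ht, ht', e1, e2]
  have h0 := le_abs_self (h t - h t')
  rcases abs_cases (f k t - f k t') with ⟨h1, -⟩ | ⟨h1, -⟩
  · have := le_expect_maxOver_signs g f k t t'
    linarith
  · have := le_expect_maxOver_signs g f k t' t
    linarith

/-- Vector contraction: a process whose increments are dominated by the largest coordinate
increment of `f` has no larger Rademacher average than the sum of the coordinates of `f`. -/
theorem contraction {n : ℕ} (g : T → ℝ) (h : Fin n → T → ℝ) (f : Fin n → K → T → ℝ)
    (H : ∀ i t t', ∃ k, |h i t - h i t'| ≤ |f i k t - f i k t'|) :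
    𝔼 s : Fin n → Bool, maxOver (fun t => g t + ∑ i, sgn (s i) * h i t) ≤
      𝔼 u : Fin n → K → Bool, maxOver fun t => g t + ∑ i, ∑ k, sgn (u i k) * f i k t := by
  induction n generalizing g with
  | zero => simp
  | succ n ih =>
    rw [expect_cons, expect_cons]
    simp only [Fin.sum_univ_succ, Fin.cons_zero, Fin.cons_succ, ← add_assoc]
    -- The term of the first sign is absorbed into `g`, which is why the induction keeps `g`
    -- arbitrary.
    calc _ ≤ 𝔼 b, 𝔼 u : Fin n → K → Bool, maxOver (fun t => (g t + sgn b * h 0 t) +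
            ∑ i, ∑ k, sgn (u i k) * f i.succ k t) :=
          expect_mono fun b => ih _ _ _ fun i => H i.succ
      _ = 𝔼 u : Fin n → K → Bool, 𝔼 b, maxOver (fun t =>
            (g t + ∑ i, ∑ k, sgn (u i k) * f i.succ k t) + sgn b * h 0 t) := by
          rw [Finset.expect_comm]
          simp_rw [add_right_comm]
      _ ≤ 𝔼 u : Fin n → K → Bool, 𝔼 v : K → Bool, maxOver (fun t =>
            (g t + ∑ i, ∑ k, sgn (u i k) * f i.succ k t) + ∑ k, sgn (v k) * f 0 k t) :=
          expect_mono fun u => contraction_step _ _ _ (H 0)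
      _ = _ := by
          rw [Finset.expect_comm]
          simp_rw [add_right_comm]

end Contraction

/-! ### Rademacher averages of neurons and networks -/

section Network

variable {T E : Type*} [Fintype T] [Nonempty T] [NormedAddCommGroup E] [InnerProductSpace ℝ E]

/-- Contraction with one coordinate replaces `ψ` by a linear function; Cauchy–Schwarz then leaves
the norm of a signed sum of inputs. -/
lemma expect_maxOver_lipschitz_le {n : ℕ} {C₁ C₃ : ℝ} {L : ℝ≥0} (hC₁ : 0 ≤ C₁) (hC₃ : 0 ≤ C₃)
    {ψ : ℝ → ℝ} (hψ : LipschitzWith L ψ) (w : T → E) (hw : ∀ t, ‖w t‖ ≤ C₃)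
    (x : Fin n → E) (hx : ∀ i, ‖x i‖ ≤ C₁) :
    𝔼 s : Fin n → Bool, maxOver (fun t => ∑ i, sgn (s i) * ψ (inner ℝ (w t) (x i))) ≤
      L * C₁ * C₃ * √n := by
  have key := contraction (K := Unit) (fun _ : T => 0) (fun i t => ψ (inner ℝ (w t) (x i)))
    (fun i _ t => L * inner ℝ (w t) (x i)) fun i t t' => ⟨(), by
      have := hψ.dist_le_mul (inner ℝ (w t) (x i)) (inner ℝ (w t') (x i))
      rw [Real.dist_eq, Real.dist_eq] at this
      rwa [← mul_sub, abs_mul, abs_of_nonneg L.coe_nonneg]⟩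
  simp only [zero_add, Finset.univ_unique, Finset.sum_singleton, PUnit.default_eq_unit] at key
  refine key.trans ?_
  rw [expect_eval_right (ι := Fin n) () fun s : Fin n → Bool =>
    maxOver fun t => ∑ i, sgn (s i) * (L * inner ℝ (w t) (x i))]
  calc _ ≤ 𝔼 s : Fin n → Bool, L * C₃ * ‖∑ i, sgn (s i) • x i‖ := by
        refine expect_mono fun s => maxOver_le fun t => ?_
        have : ∑ i, sgn (s i) * (L * inner ℝ (w t) (x i)) =
            L * inner ℝ (w t) (∑ i, sgn (s i) • x i) := by
          rw [inner_sum, Finset.mul_sum]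
          exact Finset.sum_congr rfl fun i _ => by rw [real_inner_smul_right]; ring
        rw [this, mul_assoc]
        refine mul_le_mul_of_nonneg_left ?_ L.2
        exact (real_inner_le_norm _ _).trans
          (mul_le_mul_of_nonneg_right (hw t) (norm_nonneg _))
    _ ≤ L * C₃ * (C₁ * √n) := by
        rw [← Finset.mul_expect]
        refine mul_le_mul_of_nonneg_left ?_ (mul_nonneg L.2 hC₃)
        simpa using expect_norm_sum_sgn_le x hC₁ hx
    _ = _ := by ring

lemma expect_maxOver_abs_neuron_le {n : ℕ} {C₁ C₃ : ℝ} {L : ℝ≥0} (hC₁ : 0 ≤ C₁) (hC₃ : 0 ≤ C₃)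
    {ρ : ℝ → ℝ} (hρ : LipschitzWith L ρ) (w : T → E) (hw : ∀ t, ‖w t‖ ≤ C₃)
    (x : Fin n → E) (hx : ∀ i, ‖x i‖ ≤ C₁) :
    𝔼 s : Fin n → Bool, maxOver (fun t => |∑ i, sgn (s i) * ρ (inner ℝ (w t) (x i))|) ≤
      (2 * L * (C₁ * C₃) + |ρ 0|) * √n := by
  have hψ : LipschitzWith L fun u => ρ u - ρ 0 := by
    simpa using hρ.sub (LipschitzWith.const (ρ 0))
  have hψ' : LipschitzWith L fun u => -(ρ u - ρ 0) := hψ.neg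
  -- Adjoining the zero weight, where `ρ u - ρ 0` vanishes, makes both one-sided maxima nonnegative,
  -- so their sum dominates the absolute value.
  let w' : Option T → E := fun o => o.elim 0 w
  have hw' : ∀ t, ‖w' t‖ ≤ C₃ := by
    rintro (_ | t)
    · simpa [w'] using hC₃
    · exact hw t
  have h1 := expect_maxOver_lipschitz_le hC₁ hC₃ hψ w' hw' x hx
  have h2 := expect_maxOver_lipschitz_le hC₁ hC₃ hψ' w' hw' x hx
  have h3 : 𝔼 s : Fin n → Bool, |∑ i, sgn (s i)| * |ρ 0| ≤ √n * |ρ 0| := by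
    rw [← Finset.expect_mul]
    refine mul_le_mul_of_nonneg_right ?_ (abs_nonneg _)
    simpa using expect_norm_sum_sgn_le (fun _ : Fin n => (1 : ℝ)) zero_le_one (by simp)
  calc _ ≤ 𝔼 s : Fin n → Bool,
        (maxOver (fun t => ∑ i, sgn (s i) * (ρ (inner ℝ (w' t) (x i)) - ρ 0)) +
          maxOver (fun t => ∑ i, sgn (s i) * -(ρ (inner ℝ (w' t) (x i)) - ρ 0)) +
          |∑ i, sgn (s i)| * |ρ 0|) := by
        refine expect_mono fun s => maxOver_le fun t => ?_
        set F := fun t => ∑ i, sgn (s i) * (ρ (inner ℝ (w' t) (x i)) - ρ 0)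
        set G := fun t => ∑ i, sgn (s i) * -(ρ (inner ℝ (w' t) (x i)) - ρ 0)
        have hF0 : 0 ≤ maxOver F := le_trans (by simp [F, w']) (le_maxOver F none)
        have hG0 : 0 ≤ maxOver G := le_trans (by simp [G, w']) (le_maxOver G none)
        have hF := le_maxOver F (some t)
        have hG := le_maxOver G (some t)
        have hGF : G (some t) = -F (some t) := by
          simp only [F, G, mul_neg, Finset.sum_neg_distrib]
        have hs : ∑ i, sgn (s i) * ρ (inner ℝ (w t) (x i)) =
            F (some t) + (∑ i, sgn (s i)) * ρ 0 := by
          simp only [F, w', Option.elim_some, mul_sub, Finset.sum_sub_distrib, Finset.sum_mul]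
          ring
        rw [hs, ← abs_mul]
        refine (abs_add_le _ _).trans (add_le_add_left ?_ _)
        exact abs_le.2 ⟨by linarith, by linarith⟩
    _ ≤ L * C₁ * C₃ * √n + L * C₁ * C₃ * √n + √n * |ρ 0| := by
        rw [Finset.expect_add_distrib, Finset.expect_add_distrib]
        exact add_le_add (add_le_add h1 h2) h3
    _ = _ := by ring

/-- The Rademacher average of the sum of all outputs of a one-hidden-layer network. -/
lemma expect_maxOver_network_le {n p M D : ℕ} {C₁ C₃ C₄ : ℝ} {L : ℝ≥0} (hC₁ : 0 ≤ C₁)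
    (hC₃ : 0 ≤ C₃) {ρ : ℝ → ℝ} (hρ : LipschitzWith L ρ)
    (W : T → Fin M → EuclideanSpace ℝ (Fin p)) (hW : ∀ t m, ‖W t m‖ ≤ C₃)
    (V : T → Fin D → Fin M → ℝ) (hV : ∀ t k, ‖V t k‖ ≤ C₄)
    (x : Fin n → EuclideanSpace ℝ (Fin p)) (hx : ∀ i, ‖x i‖ ≤ C₁) {c : ℝ} (hc : 0 ≤ c) :
    𝔼 u : Fin n → Fin D → Bool,
        maxOver (fun t => ∑ i, ∑ k, sgn (u i k) * (c * network ρ (W t) (V t) (x i) k)) ≤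
      c * (D * (M * (C₄ * ((2 * L * (C₁ * C₃) + |ρ 0|) * √n)))) := by
  calc _ ≤ 𝔼 u : Fin n → Fin D → Bool, c * ∑ k, ∑ m, C₄ *
        maxOver (fun t => |∑ i, sgn (u i k) * ρ (inner ℝ (W t m) (x i))|) := by
        refine expect_mono fun u => maxOver_le fun t => ?_
        have : ∑ i, ∑ k, sgn (u i k) * (c * network ρ (W t) (V t) (x i) k) =
            c * ∑ k, ∑ m, V t k m * ∑ i, sgn (u i k) * ρ (inner ℝ (W t m) (x i)) := by
          rw [Finset.sum_comm, Finset.mul_sum]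
          refine Finset.sum_congr rfl fun k _ => ?_
          simp only [network, features, Finset.mul_sum]
          rw [Finset.sum_comm]
          exact Finset.sum_congr rfl fun m _ => Finset.sum_congr rfl fun i _ => by ring
        rw [this]
        refine mul_le_mul_of_nonneg_left ?_ hc
        refine Finset.sum_le_sum fun k _ => Finset.sum_le_sum fun m _ => ?_
        refine (le_abs_self _).trans ?_
        rw [abs_mul]
        exact mul_le_mul ((norm_le_pi_norm (V t k) m).trans (hV t k))
          (le_maxOver (fun t => |∑ i, sgn (u i k) * ρ (inner ℝ (W t m) (x i))|) t)
          (abs_nonneg _) ((norm_nonneg _).trans (hV t k))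
    _ = c * ∑ k : Fin D, ∑ m : Fin M, C₄ * 𝔼 s : Fin n → Bool,
        maxOver (fun t => |∑ i, sgn (s i) * ρ (inner ℝ (W t m) (x i))|) := by
        rw [← Finset.mul_expect, Finset.expect_sum_comm]
        congr 1
        refine Finset.sum_congr rfl fun k _ => ?_
        rw [Finset.expect_sum_comm]
        refine Finset.sum_congr rfl fun m _ => ?_
        rw [← Finset.mul_expect]
        congr 1
        exact expect_eval_right k fun s : Fin n → Bool =>
          maxOver fun t => |∑ i, sgn (s i) * ρ (inner ℝ (W t m) (x i))|
    _ ≤ c * ∑ k : Fin D, ∑ m : Fin M, C₄ * ((2 * L * (C₁ * C₃) + |ρ 0|) * √n) := by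
        refine mul_le_mul_of_nonneg_left ?_ hc
        refine Finset.sum_le_sum fun k _ => Finset.sum_le_sum fun m _ => ?_
        -- An element is needed only to see that `C₄` is nonnegative.
        obtain ⟨t⟩ := ‹Nonempty T›
        exact mul_le_mul_of_nonneg_left
          (expect_maxOver_abs_neuron_le hC₁ hC₃ hρ (fun t => W t m) (fun t => hW t m) x hx)
          ((norm_nonneg _).trans (hV t k))
    _ = _ := by simp

end Network

/-! ### McDiarmid's inequality -/

section Concentration

variable {Z : Type*} [MeasurableSpace Z] {Q : Measure Z} [IsProbabilityMeasure Q]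

lemma integrable_of_abs_le {Ω : Type*} [MeasurableSpace Ω] {μ : Measure Ω} [IsFiniteMeasure μ]
    {f : Ω → ℝ} (hf : Measurable f) {K : ℝ} (hK : ∀ ω, |f ω| ≤ K) : Integrable f μ :=
  Integrable.of_bound hf.aestronglyMeasurable K (Filter.Eventually.of_forall hK)

lemma measurable_cons {n : ℕ} :
    Measurable fun p : Z × (Fin n → Z) => (Fin.cons p.1 p.2 : Fin (n + 1) → Z) := by
  refine measurable_pi_lambda _ fun i => ?_
  refine Fin.cases ?_ (fun j => ?_) i
  · simpa using measurable_fst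
  · simp only [Fin.cons_succ]
    exact (measurable_pi_apply j).comp measurable_snd

lemma integral_pi_succ {n : ℕ} {F : (Fin (n + 1) → Z) → ℝ}
    (hF : Integrable F (Measure.pi fun _ : Fin (n + 1) => Q)) :
    ∫ S, F S ∂(Measure.pi fun _ : Fin (n + 1) => Q) =
      ∫ S, ∫ z, F (Fin.cons z S) ∂Q ∂(Measure.pi fun _ : Fin n => Q) := by
  have hm := (measurePreserving_piFinSuccAbove (fun _ : Fin (n + 1) => Q) 0).symm
  have e : ∀ p : Z × (Fin n → Z),
      (MeasurableEquiv.piFinSuccAbove (fun _ : Fin (n + 1) => Z) 0).symm p = Fin.cons p.1 p.2 := by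
    intro p
    simp [MeasurableEquiv.piFinSuccAbove, Fin.insertNthEquiv]
  have hi : Integrable (fun p : Z × (Fin n → Z) => F (Fin.cons p.1 p.2))
      (Q.prod (Measure.pi fun _ : Fin n => Q)) := by
    have := hm.integrable_comp_of_integrable hF
    refine this.congr (Filter.Eventually.of_forall fun p => ?_)
    simp only [Function.comp, e]
  rw [← hm.integral_comp', ← integral_prod_symm _ hi]
  simp_rw [e]

/-- Hoeffding's lemma: oscillation at most `c` confines `X` to an interval of length `c` starting at
its infimum. -/
lemma integral_exp_centered_le {X : Z → ℝ} (hX : Measurable X) {K : ℝ} (hK : ∀ z, |X z| ≤ K)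
    {c : ℝ} (hc : ∀ z z', |X z - X z'| ≤ c) (t : ℝ) :
    ∫ z, Real.exp (t * (X z - ∫ y, X y ∂Q)) ∂Q ≤ Real.exp (c ^ 2 / 4 * t ^ 2 / 2) := by
  obtain ⟨z₀⟩ : Nonempty Z := Q.nonempty_of_neZero
  have hbdd : BddBelow (Set.range X) :=
    ⟨-K, by rintro _ ⟨z, rfl⟩; exact (abs_le.1 (hK z)).1⟩
  have h := ProbabilityTheory.hasSubgaussianMGF_of_mem_Icc (μ := Q) (a := ⨅ z, X z)
    (b := (⨅ z, X z) + c) hX.aemeasurable (Filter.Eventually.of_forall fun z => by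
      have : Nonempty Z := ⟨z₀⟩
      refine ⟨ciInf_le hbdd z, ?_⟩
      rw [← sub_le_iff_le_add]
      exact le_ciInf fun z' => by linarith [(abs_le.1 (hc z z')).2])
  refine (h.mgf_le t).trans (le_of_eq ?_)
  congr 1
  simp only [add_sub_cancel_left, NNReal.coe_pow, NNReal.coe_div, coe_nnnorm, NNReal.coe_ofNat,
    Real.norm_eq_abs, div_pow, sq_abs]
  ring

/-- McDiarmid's bounded difference inequality, as a bound on the moment generating function. -/
theorem integral_exp_le_of_boundedDifferences {n : ℕ} {f : (Fin n → Z) → ℝ} (hf : Measurable f)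
    {K : ℝ} (hK : ∀ S, |f S| ≤ K) {c : ℝ}
    (hc : ∀ S i z, |f S - f (Function.update S i z)| ≤ c) (t : ℝ) :
    ∫ S, Real.exp (t * (f S - ∫ S', f S' ∂(Measure.pi fun _ : Fin n => Q)))
        ∂(Measure.pi fun _ : Fin n => Q) ≤ Real.exp (n * (c ^ 2 / 4 * t ^ 2 / 2)) := by
  induction n generalizing K with
  | zero =>
    have : ∀ S, f S = f default := fun S => congrArg f (Subsingleton.elim _ _)
    simp_rw [this]
    simp
  | succ n ih =>
    set μ := Measure.pi fun _ : Fin n => Q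
    have hfc : Measurable fun p : Z × (Fin n → Z) => f (Fin.cons p.1 p.2) :=
      hf.comp measurable_cons
    have hfS : ∀ S : Fin n → Z, Measurable fun z => f (Fin.cons z S) := fun S =>
      hfc.comp measurable_prodMk_right
    -- Averaging out the first coordinate preserves the bounded differences, so the induction
    -- hypothesis applies to `g`; the remaining fluctuation `f - g` is handled by Hoeffding's lemma
    -- for each fixed `S`.
    set g : (Fin n → Z) → ℝ := fun S => ∫ z, f (Fin.cons z S) ∂Q with hg
    have hgm : Measurable g :=
      (StronglyMeasurable.integral_prod_left' (μ := Q) hfc.stronglyMeasurable).measurable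
    have hint : ∀ S : Fin n → Z, Integrable (fun z => f (Fin.cons z S)) Q := fun S =>
      integrable_of_abs_le (hfS S) fun z => hK _
    have hgK : ∀ S, |g S| ≤ K := fun S => by
      have := norm_integral_le_of_norm_le_const (μ := Q) (f := fun z => f (Fin.cons z S))
        (Filter.Eventually.of_forall fun z => hK (Fin.cons z S))
      simpa using this
    have hgc : ∀ S i z, |g S - g (Function.update S i z)| ≤ c := fun S i z' => by
      rw [hg, ← integral_sub (hint _) (hint _)]
      have := norm_integral_le_of_norm_le_const (μ := Q)
        (f := fun z => f (Fin.cons z S) - f (Fin.cons z (Function.update S i z'))) (C := c)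
        (Filter.Eventually.of_forall fun z => by
          rw [Fin.cons_update]
          exact hc _ _ _)
      simpa using this
    have hmean : ∫ S, f S ∂(Measure.pi fun _ : Fin (n + 1) => Q) = ∫ S, g S ∂μ :=
      integral_pi_succ (integrable_of_abs_le hf hK)
    rw [hmean]
    set m := ∫ S, g S ∂μ
    have hexp : ∀ {Ω : Type _} [MeasurableSpace Ω] {ν : Measure Ω} [IsFiniteMeasure ν] {h : Ω → ℝ}
        {C : ℝ}, Measurable h → (∀ ω, |h ω| ≤ C) →
        Integrable (fun ω => Real.exp (t * (h ω - m))) ν := by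
      intro Ω _ ν _ h C hh hC
      refine integrable_of_abs_le (K := Real.exp (|t| * (C + |m|))) (by fun_prop) fun ω => ?_
      rw [abs_of_pos (Real.exp_pos _), Real.exp_le_exp]
      refine (le_abs_self _).trans ?_
      rw [abs_mul]
      refine mul_le_mul_of_nonneg_left ?_ (abs_nonneg _)
      exact (abs_sub _ _).trans (add_le_add_left (hC ω) _)
    rw [integral_pi_succ (hexp hf hK)]
    have hle : ∀ S, ∫ z, Real.exp (t * (f (Fin.cons z S) - m)) ∂Q ≤
        Real.exp (t * (g S - m)) * Real.exp (c ^ 2 / 4 * t ^ 2 / 2) := fun S => by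
      have e : ∀ z, Real.exp (t * (f (Fin.cons z S) - m)) =
          Real.exp (t * (g S - m)) * Real.exp (t * (f (Fin.cons z S) - g S)) := fun z => by
        rw [← Real.exp_add]
        congr 1
        ring
      simp_rw [e]
      rw [integral_const_mul]
      refine mul_le_mul_of_nonneg_left ?_ (Real.exp_pos _).le
      refine integral_exp_centered_le (hfS S) (fun z => hK _) (fun z z' => ?_) t
      have := hc (Fin.cons z S) 0 z'
      rwa [Fin.update_cons_zero] at this
    have hi2 : Integrable (fun S => Real.exp (t * (g S - m))) μ := hexp hgm hgK
    have hi1 : Integrable (fun S => ∫ z, Real.exp (t * (f (Fin.cons z S) - m)) ∂Q) μ := by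
      refine (hi2.mul_const (Real.exp (c ^ 2 / 4 * t ^ 2 / 2))).mono' ?_ (Filter.Eventually.of_forall fun S => ?_)
      · have : Measurable fun p : Z × (Fin n → Z) => Real.exp (t * (f (Fin.cons p.1 p.2) - m)) :=
          ((hfc.sub_const m).const_mul t).exp
        exact (StronglyMeasurable.integral_prod_left' (μ := Q)
          this.stronglyMeasurable).aestronglyMeasurable
      · rw [Real.norm_eq_abs, abs_of_nonneg (integral_nonneg fun z => (Real.exp_pos _).le)]
        exact hle S
    calc _ ≤ ∫ S, Real.exp (t * (g S - m)) * Real.exp (c ^ 2 / 4 * t ^ 2 / 2) ∂μ :=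
          integral_mono hi1 (hi2.mul_const _) hle
      _ ≤ Real.exp (n * (c ^ 2 / 4 * t ^ 2 / 2)) * Real.exp (c ^ 2 / 4 * t ^ 2 / 2) := by
          rw [integral_mul_const]
          exact mul_le_mul_of_nonneg_right (ih hgm hgK hgc) (Real.exp_pos _).le
      _ = _ := by
          rw [← Real.exp_add]
          congr 1
          push_cast
          ring

theorem hasSubgaussianMGF_of_boundedDifferences {n : ℕ} {f : (Fin n → Z) → ℝ} (hf : Measurable f)
    {K : ℝ} (hK : ∀ S, |f S| ≤ K) {c : ℝ≥0}
    (hc : ∀ S i z, |f S - f (Function.update S i z)| ≤ c) :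
    ProbabilityTheory.HasSubgaussianMGF
      (fun S => f S - ∫ S', f S' ∂(Measure.pi fun _ : Fin n => Q)) (n * (c ^ 2 / 4))
      (Measure.pi fun _ : Fin n => Q) where
  integrable_exp_mul t := by
    set m := ∫ S', f S' ∂(Measure.pi fun _ : Fin n => Q)
    refine ProbabilityTheory.integrable_exp_mul_of_mem_Icc (a := -K - m) (b := K - m)
      (hf.sub_const _).aemeasurable (Filter.Eventually.of_forall fun S => ?_)
    have := abs_le.1 (hK S)
    exact ⟨by linarith, by linarith⟩
  mgf_le t := by
    refine (integral_exp_le_of_boundedDifferences (Q := Q) hf hK hc t).trans (le_of_eq ?_)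
    congr 1
    push_cast
    ring

end Concentration

/-! ### Symmetrization with a ghost sample -/

section Symmetrization

variable {Z T : Type*} [MeasurableSpace Z] {Q : Measure Z} [IsProbabilityMeasure Q]

/-- Swapping the two components of the pairs where the sign is negative. -/
def swapBy {N : ℕ} (s : Fin N → Bool) (P : Fin N → Z × Z) (i : Fin N) : Z × Z :=
  if s i then P i else (P i).swap

lemma measurePreserving_swapBy {N : ℕ} (s : Fin N → Bool) :
    MeasurePreserving (swapBy (Z := Z) s) (Measure.pi fun _ : Fin N => Q.prod Q)
      (Measure.pi fun _ : Fin N => Q.prod Q) := by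
  refine measurePreserving_pi (fun _ : Fin N => Q.prod Q) (fun _ : Fin N => Q.prod Q)
    (f := fun i (P : Z × Z) => if s i then P else P.swap) fun i => ?_
  cases s i
  · simpa using Measure.measurePreserving_swap (μ := Q) (ν := Q)
  · simp only [if_true]
    exact MeasurePreserving.id (Q.prod Q)

lemma integral_sum_pi {N : ℕ} {h : Z → ℝ} (hh : Integrable h Q) :
    ∫ S : Fin N → Z, ∑ i, h (S i) ∂(Measure.pi fun _ => Q) = N * ∫ z, h z ∂Q := by
  have he : ∀ i : Fin N, MeasurePreserving (Function.eval i)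
      (Measure.pi fun _ : Fin N => Q) Q := fun i => measurePreserving_eval (fun _ => Q) i
  rw [integral_finsetSum (f := fun i (S : Fin N → Z) => h (S i)) _ fun i _ =>
    (he i).integrable_comp_of_integrable hh]
  have : ∀ i : Fin N, ∫ S : Fin N → Z, h (S i) ∂(Measure.pi fun _ => Q) = ∫ z, h z ∂Q :=
    fun i => by
      have := integral_map (he i).measurable.aemeasurable (μ := Measure.pi fun _ : Fin N => Q)
        (f := h) (by rw [(he i).map_eq]; exact hh.1)
      rw [(he i).map_eq] at this
      exact this.symm
  simp [this]

variable [Fintype T] [Nonempty T]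

lemma abs_maxOver_le {g : T → ℝ} {K : ℝ} (h : ∀ t, |g t| ≤ K) : |maxOver g| ≤ K := by
  obtain ⟨t, ht⟩ := exists_eq_maxOver g
  rw [ht]
  exact h t

/-- Symmetrization: the expected one-sided uniform deviation is at most twice the Rademacher
average. -/
theorem integral_maxOver_deviation_le {N : ℕ} {l : T → Z → ℝ} (hl : ∀ t, Measurable (l t))
    {K : ℝ} (hK : ∀ t z, |l t z| ≤ K) {R : ℝ}
    (hR : ∀ S : Fin N → Z,
      𝔼 s : Fin N → Bool, maxOver (fun t => ∑ i, sgn (s i) * l t (S i)) ≤ R) :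
    ∫ S : Fin N → Z, maxOver (fun t => N * (∫ z, l t z ∂Q) - ∑ i, l t (S i))
      ∂(Measure.pi fun _ => Q) ≤ 2 * R := by
  set μ := Measure.pi fun _ : Fin N => Q
  set μ₂ := Measure.pi fun _ : Fin N => Q.prod Q
  have hli : ∀ t, Integrable (l t) Q := fun t => integrable_of_abs_le (hl t) (hK t)
  let Ψ : (Fin N → Z) × (Fin N → Z) → ℝ := fun p =>
    maxOver fun t => ∑ i, (l t (p.1 i) - l t (p.2 i))
  have hsum : ∀ (s : Fin N → Bool) (t : T) (P : Fin N → Z × Z),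
      |∑ i, sgn (s i) * (l t (P i).1 - l t (P i).2)| ≤ N * (2 * K) := fun s t P => by
    refine (Finset.abs_sum_le_sum_abs _ _).trans ?_
    calc _ ≤ ∑ _i : Fin N, 2 * K := Finset.sum_le_sum fun i _ => by
          have h1 : |sgn (s i)| = 1 := by cases s i <;> simp [sgn]
          rw [abs_mul, h1, one_mul]
          linarith [abs_sub (l t (P i).1) (l t (P i).2), hK t (P i).1, hK t (P i).2]
      _ = _ := by simp
  have hΨm : Measurable Ψ := measurable_maxOver fun t => by
    refine Finset.measurable_sum _ fun i _ => ?_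
    exact ((hl t).comp ((measurable_pi_apply i).comp measurable_fst)).sub
      ((hl t).comp ((measurable_pi_apply i).comp measurable_snd))
  have hΨK : ∀ p, |Ψ p| ≤ N * (2 * K) := fun p => abs_maxOver_le fun t => by
    simpa [sgn] using hsum (fun _ => true) t fun i => (p.1 i, p.2 i)
  have hΨi : Integrable Ψ (μ.prod μ) := integrable_of_abs_le hΨm hΨK
  let Φ : (Fin N → Bool) → (Fin N → Z × Z) → ℝ := fun s P =>
    maxOver fun t => ∑ i, sgn (s i) * (l t (P i).1 - l t (P i).2)
  have hΦm : ∀ s, Measurable (Φ s) := fun s => measurable_maxOver fun t => by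
    refine Finset.measurable_sum _ fun i _ => ?_
    exact (((hl t).comp (measurable_fst.comp (measurable_pi_apply i))).sub
      ((hl t).comp (measurable_snd.comp (measurable_pi_apply i)))).const_mul _
  have hΦi : ∀ s, Integrable (Φ s) μ₂ := fun s =>
    integrable_of_abs_le (hΦm s) fun P => abs_maxOver_le fun t => hsum s t P
  -- The mean is the average over a ghost sample `S'`, and the maximum of averages is at most the
  -- average of maxima.
  have step1 : ∫ S, maxOver (fun t => N * (∫ z, l t z ∂Q) - ∑ i, l t (S i)) ∂μ ≤
      ∫ S, ∫ S', Ψ (S', S) ∂μ ∂μ := by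
    have hN : ∀ t, |∫ z, l t z ∂Q| ≤ K := fun t => by
      simpa using norm_integral_le_of_norm_le_const (μ := Q) (f := l t) (C := K)
        (Filter.Eventually.of_forall (hK t))
    refine integral_mono ?_ hΨi.integral_prod_right fun S => ?_
    · refine integrable_of_abs_le (K := N * K + N * K) (measurable_maxOver fun t => ?_)
        fun S => abs_maxOver_le fun t => ?_
      · exact measurable_const.sub
          (Finset.measurable_sum _ fun i _ => (hl t).comp (measurable_pi_apply i))
      · refine (abs_sub _ _).trans (add_le_add ?_ ?_)
        · rw [abs_mul, Nat.abs_cast]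
          exact mul_le_mul_of_nonneg_left (hN t) (Nat.cast_nonneg _)
        · refine (Finset.abs_sum_le_sum_abs _ _).trans ?_
          calc _ ≤ ∑ _i : Fin N, K := Finset.sum_le_sum fun i _ => hK t (S i)
            _ = _ := by simp
    · refine maxOver_le fun t => ?_
      have hs : Integrable (fun S' : Fin N → Z => ∑ i, l t (S' i)) μ :=
        integrable_finsetSum _ fun i _ =>
          (measurePreserving_eval (fun _ => Q) i).integrable_comp_of_integrable (hli t)
      have : N * (∫ z, l t z ∂Q) - ∑ i, l t (S i) =
          ∫ S', ((∑ i, l t (S' i)) - ∑ i, l t (S i)) ∂μ := by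
        rw [integral_sub hs (integrable_const _), integral_sum_pi (hli t)]
        simp
      rw [this]
      refine integral_mono (hs.sub (integrable_const _))
        (integrable_of_abs_le (hΨm.comp measurable_prodMk_right) fun _ => hΨK _) fun S' => ?_
      dsimp only
      rw [← Finset.sum_sub_distrib]
      exact le_maxOver (fun t => ∑ i, (l t (S' i) - l t (S i))) t
  have step2 : ∫ S, ∫ S', Ψ (S', S) ∂μ ∂μ = ∫ P, Φ (fun _ => true) P ∂μ₂ := by
    rw [← integral_prod_symm _ hΨi,
      ← (measurePreserving_arrowProdEquivProdArrow Z Z (Fin N) (fun _ => Q)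
        (fun _ => Q)).integral_comp']
    refine integral_congr_ae (Filter.Eventually.of_forall fun P => ?_)
    simp [Ψ, Φ, sgn, MeasurableEquiv.arrowProdEquivProdArrow, Equiv.arrowProdEquivProdArrow]
  -- Negating the sign of an index amounts to exchanging its true and ghost points, which preserves
  -- the product measure.
  have step3 : ∀ s, ∫ P, Φ s P ∂μ₂ = ∫ P, Φ (fun _ => true) P ∂μ₂ := fun s => by
    have hp := measurePreserving_swapBy (Q := Q) s
    have hmap := integral_map (μ := μ₂) hp.measurable.aemeasurable
      (f := Φ fun _ => true) (hΦm _).aestronglyMeasurable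
    rw [hp.map_eq] at hmap
    rw [hmap]
    refine integral_congr_ae (Filter.Eventually.of_forall fun P => ?_)
    simp only [Φ]
    congr 1
    funext t
    refine Finset.sum_congr rfl fun i _ => ?_
    cases h : s i <;> simp [swapBy, h, sgn]
  have step4 : ∫ P, Φ (fun _ => true) P ∂μ₂ = ∫ P, 𝔼 s, Φ s P ∂μ₂ := by
    simp_rw [Fintype.expect_eq_sum_div_card]
    rw [integral_div, integral_finsetSum _ fun s _ => hΦi s]
    simp_rw [step3]
    simp
  rw [step2, step4] at step1
  refine step1.trans ?_
  have hb : ∀ P, 𝔼 s, Φ s P ≤ 2 * R := fun P => by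
    have h2 : 𝔼 s : Fin N → Bool, maxOver (fun t => ∑ i, sgn (!s i) * l t (P i).2) ≤ R := by
      rw [← Fintype.expect_equiv (Equiv.piCongrRight fun _ : Fin N => Equiv.boolNot)
        (fun s : Fin N → Bool => maxOver fun t => ∑ i, sgn (!!s i) * l t (P i).2) _
        fun s => rfl]
      simpa using hR fun i => (P i).2
    calc 𝔼 s, Φ s P ≤ 𝔼 s : Fin N → Bool, (maxOver (fun t => ∑ i, sgn (s i) * l t (P i).1) +
          maxOver fun t => ∑ i, sgn (!s i) * l t (P i).2) := by
          refine expect_mono fun s => ?_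
          refine le_trans (maxOver_mono fun t => le_of_eq ?_) (maxOver_add_le _ _)
          rw [← Finset.sum_add_distrib]
          exact Finset.sum_congr rfl fun i _ => by rw [sgn_not]; ring
      _ ≤ 2 * R := by
          rw [Finset.expect_add_distrib]
          linarith [hR fun i => (P i).1]
  have hi : Integrable (fun P => 𝔼 s, Φ s P) μ₂ := by
    simp_rw [Fintype.expect_eq_sum_div_card]
    exact (integrable_finsetSum _ fun s _ => hΦi s).div_const _
  calc _ ≤ ∫ _P, 2 * R ∂μ₂ := integral_mono hi (integrable_const _) hb
    _ = 2 * R := by simp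

end Symmetrization

/-! ### Uniform deviation relative to a competitor -/

section Deviation

variable {Z T : Type*} [MeasurableSpace Z] {Q : Measure Z} [IsProbabilityMeasure Q]

/-- The gap `E l_t - (1/N) ∑ᵢ l_t(Sᵢ)` between mean and sample mean. -/
noncomputable def gap (Q : Measure Z) {N : ℕ} (l : T → Z → ℝ) (t : T) (S : Fin N → Z) : ℝ :=
  (∫ z, l t z ∂Q) - 1 / (N : ℝ) * ∑ i, l t (S i)

omit [IsProbabilityMeasure Q] in
lemma measurable_gap {N : ℕ} {l : T → Z → ℝ} (hl : ∀ t, Measurable (l t)) (t : T) :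
    Measurable fun S : Fin N → Z => gap Q l t S :=
  measurable_const.sub ((Finset.measurable_sum _ fun i _ =>
    (hl t).comp (measurable_pi_apply i)).const_mul _)

lemma abs_gap_le {N : ℕ} (hN : 1 ≤ N) {l : T → Z → ℝ} {B : ℝ} (h0 : ∀ t z, 0 ≤ l t z)
    (hB : ∀ t z, l t z ≤ B) (t : T) (S : Fin N → Z) : |gap Q l t S| ≤ B := by
  have hN' : (0 : ℝ) < N := by exact_mod_cast hN
  have hint : |∫ z, l t z ∂Q| ≤ B := by
    simpa using norm_integral_le_of_norm_le_const (μ := Q) (f := l t) (C := B)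
      (Filter.Eventually.of_forall fun z => by
        rw [Real.norm_eq_abs, abs_of_nonneg (h0 t z)]
        exact hB t z)
  have hint0 : 0 ≤ ∫ z, l t z ∂Q := integral_nonneg (h0 t)
  have hs0 : 0 ≤ 1 / (N : ℝ) * ∑ i, l t (S i) :=
    mul_nonneg (by positivity) (Finset.sum_nonneg fun i _ => h0 t _)
  have hs : 1 / (N : ℝ) * ∑ i, l t (S i) ≤ B := by
    rw [one_div, inv_mul_le_iff₀ hN']
    calc _ ≤ ∑ _i : Fin N, B := Finset.sum_le_sum fun i _ => hB t _
      _ = _ := by simp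
  have := (abs_le.1 hint).2
  exact abs_le.2 ⟨by unfold gap; linarith, by unfold gap; linarith⟩

omit [IsProbabilityMeasure Q] in
lemma abs_gap_sub_update_le {N : ℕ} {l : T → Z → ℝ} {B : ℝ}
    (h0 : ∀ t z, 0 ≤ l t z) (hB : ∀ t z, l t z ≤ B) (t : T) (S : Fin N → Z) (i : Fin N) (z : Z) :
    |gap Q l t S - gap Q l t (Function.update S i z)| ≤ B / N := by
  have e : gap Q l t S - gap Q l t (Function.update S i z) =
      1 / (N : ℝ) * (l t z - l t (S i)) := by
    have : ∑ j, (l t (Function.update S i z j) - l t (S j)) = l t z - l t (S i) := by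
      rw [Finset.sum_eq_single i]
      · simp
      · intro j _ hj
        simp [hj]
      · simp
    rw [← this, Finset.sum_sub_distrib, gap, gap]
    ring
  rw [e, abs_mul, abs_of_nonneg (by positivity : (0 : ℝ) ≤ 1 / N), one_div, div_eq_inv_mul]
  refine mul_le_mul_of_nonneg_left (abs_le.2 ⟨?_, ?_⟩) (by positivity)
  · linarith [h0 t z, hB t (S i)]
  · linarith [h0 t (S i), hB t z]

/-- Uniform deviation bound for a finite class, relative to a fixed competitor `t₀`. -/
theorem le_measure_uniform_gap_of_finite {κ : Type*} [Fintype κ] [Nonempty κ] {N : ℕ} (hN : 1 ≤ N)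
    {l : T → Z → ℝ} (hl : ∀ t, Measurable (l t)) {B : ℝ} (hBpos : 0 < B) (h0 : ∀ t z, 0 ≤ l t z)
    (hB : ∀ t z, l t z ≤ B) (τ : κ → T) {R : ℝ}
    (hR : ∀ S : Fin N → Z,
      𝔼 s : Fin N → Bool, maxOver (fun j => ∑ i, sgn (s i) * l (τ j) (S i)) ≤ R)
    (t₀ : T) {δ : ℝ} (hδ0 : 0 < δ) (hδ1 : δ < 1) :
    ENNReal.ofReal (1 - δ) ≤ (Measure.pi fun _ : Fin N => Q) {S | ∀ j,
      gap Q l (τ j) S - gap Q l t₀ S ≤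
        2 * R / N + B * √(2 * Real.log (2 / δ) / (N : ℝ))} := by
  set μ := Measure.pi fun _ : Fin N => Q
  have hN' : (0 : ℝ) < N := by exact_mod_cast hN
  set ε := B * √(2 * Real.log (2 / δ) / (N : ℝ)) with hε
  have hlog : 0 < Real.log (2 / δ) :=
    Real.log_pos (by rw [lt_div_iff₀ hδ0]; linarith)
  have hεpos : 0 < ε := by positivity
  let f : (Fin N → Z) → ℝ := fun S => maxOver (fun j => gap Q l (τ j) S) - gap Q l t₀ S
  have hmm : Measurable fun S : Fin N → Z => maxOver fun j => gap Q l (τ j) S :=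
    measurable_maxOver fun j => measurable_gap hl (τ j)
  have hmK : ∀ S : Fin N → Z, |maxOver fun j => gap Q l (τ j) S| ≤ B := fun S =>
    abs_maxOver_le fun j => abs_gap_le hN h0 hB (τ j) S
  have hfm : Measurable f := hmm.sub (measurable_gap hl t₀)
  have hfK : ∀ S, |f S| ≤ B + B := fun S =>
    (abs_sub _ _).trans (add_le_add (hmK S) (abs_gap_le hN h0 hB t₀ S))
  -- Replacing one sample point moves the maximal gap and the competitor's gap by at most `B / N`
  -- each.
  let c : ℝ≥0 := ⟨2 * B / N, by positivity⟩
  have hfc : ∀ S i z, |f S - f (Function.update S i z)| ≤ c := fun S i z => by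
    have h1 : |maxOver (fun j => gap Q l (τ j) S) -
        maxOver fun j => gap Q l (τ j) (Function.update S i z)| ≤ B / N :=
      abs_maxOver_sub_le fun j => abs_gap_sub_update_le h0 hB (τ j) S i z
    have h2 := abs_gap_sub_update_le (Q := Q) h0 hB t₀ S i z
    have hc : (c : ℝ) = B / N + B / N := by
      change 2 * B / N = _
      ring
    rw [hc]
    have e : f S - f (Function.update S i z) = (maxOver (fun j => gap Q l (τ j) S) -
        maxOver fun j => gap Q l (τ j) (Function.update S i z)) -
        (gap Q l t₀ S - gap Q l t₀ (Function.update S i z)) := by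
      simp only [f]
      ring
    rw [e]
    exact (abs_sub _ _).trans (add_le_add h1 h2)
  have hgap0 : ∫ S, gap Q l t₀ S ∂μ = 0 := by
    have hli : Integrable (l t₀) Q := integrable_of_abs_le (hl t₀) fun z => by
      rw [abs_of_nonneg (h0 t₀ z)]
      exact hB t₀ z
    have hs : Integrable (fun S : Fin N → Z => ∑ i, l t₀ (S i)) μ :=
      integrable_finsetSum _ fun i _ =>
        (measurePreserving_eval (fun _ => Q) i).integrable_comp_of_integrable hli
    simp only [gap]
    rw [integral_sub (integrable_const _) (hs.const_mul _), integral_const_mul,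
      integral_sum_pi hli]
    simp
    field_simp
    simp
  have hmean : ∫ S, f S ∂μ ≤ 2 * R / N := by
    have hsym := integral_maxOver_deviation_le (Q := Q) (l := fun j => l (τ j))
      (fun j => hl (τ j)) (K := B)
      (fun j z => by rw [abs_of_nonneg (h0 _ z)]; exact hB _ z) hR
    rw [integral_sub (integrable_of_abs_le hmm hmK)
      (integrable_of_abs_le (measurable_gap hl t₀) (abs_gap_le hN h0 hB t₀)), hgap0, sub_zero,
      le_div_iff₀ hN', mul_comm, ← integral_const_mul]
    refine le_trans (le_of_eq ?_) hsym
    refine integral_congr_ae (Filter.Eventually.of_forall fun S => ?_)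
    obtain ⟨a, ha⟩ := exists_eq_maxOver fun j => gap Q l (τ j) S
    have hscale : ∀ j, N * gap Q l (τ j) S = N * (∫ z, l (τ j) z ∂Q) - ∑ i, l (τ j) (S i) :=
      fun j => by
        rw [gap]
        field_simp
    dsimp only
    refine le_antisymm ?_ (maxOver_le fun j => ?_)
    · rw [ha, hscale]
      exact le_maxOver (fun j => N * (∫ z, l (τ j) z ∂Q) - ∑ i, l (τ j) (S i)) a
    · rw [← hscale]
      exact mul_le_mul_of_nonneg_left (le_maxOver (fun j => gap Q l (τ j) S) j) hN'.le
  have htail := (hasSubgaussianMGF_of_boundedDifferences (Q := Q) hfm hfK hfc).measure_ge_le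
    hεpos.le
  -- With variance proxy `N * c ^ 2 / 4 = B ^ 2 / N`, the choice of `ε` makes the tail exactly `δ /
  -- 2`.
  have hexp : -ε ^ 2 / (2 * ((N * (c ^ 2 / 4) : ℝ≥0) : ℝ)) = -Real.log (2 / δ) := by
    have hc : (c : ℝ) = 2 * B / N := rfl
    push_cast
    rw [hc, hε, mul_pow, Real.sq_sqrt (by positivity)]
    field_simp
    ring
  rw [hexp, Real.exp_neg, Real.exp_log (by positivity), inv_div] at htail
  set A := {S : Fin N → Z | ∀ j, gap Q l (τ j) S - gap Q l t₀ S ≤ 2 * R / N + ε}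
  have hAm : MeasurableSet A := by
    have : A = ⋂ j, {S | gap Q l (τ j) S - gap Q l t₀ S ≤ 2 * R / N + ε} := by
      ext S
      simp [A]
    rw [this]
    exact MeasurableSet.iInter fun j =>
      measurableSet_le ((measurable_gap hl _).sub (measurable_gap hl _)) measurable_const
  have hAc : μ.real Aᶜ ≤ δ := by
    refine (measureReal_mono fun S hS => ?_).trans (htail.trans (by linarith))
    simp only [A, Set.mem_compl_iff, Set.mem_ofPred_eq, not_forall, not_le] at hS ⊢
    obtain ⟨j, hj⟩ := hS
    have := le_maxOver (fun j => gap Q l (τ j) S) j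
    have hfS : f S = maxOver (fun j => gap Q l (τ j) S) - gap Q l t₀ S := rfl
    linarith
  have := probReal_compl_eq_one_sub (μ := μ) hAm
  rw [← ofReal_measureReal (μ := μ) (s := A)]
  exact ENNReal.ofReal_le_ofReal (by linarith)

/-- Uniform deviation bound for a sequence of functions. -/
theorem le_measure_uniform_gap {N : ℕ} (hN : 1 ≤ N)
    {l : T → Z → ℝ} (hl : ∀ t, Measurable (l t)) {B : ℝ} (hBpos : 0 < B) (h0 : ∀ t z, 0 ≤ l t z)
    (hB : ∀ t z, l t z ≤ B) (τ : ℕ → T) {R : ℝ}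
    (hR : ∀ (m : ℕ) (S : Fin N → Z), 𝔼 s : Fin N → Bool,
      maxOver (fun j : Fin (m + 1) => ∑ i, sgn (s i) * l (τ j) (S i)) ≤ R)
    (t₀ : T) {δ : ℝ} (hδ0 : 0 < δ) (hδ1 : δ < 1) :
    ENNReal.ofReal (1 - δ) ≤ (Measure.pi fun _ : Fin N => Q) {S | ∀ j,
      gap Q l (τ j) S - gap Q l t₀ S ≤
        2 * R / N + B * √(2 * Real.log (2 / δ) / (N : ℝ))} := by
  set b := 2 * R / N + B * √(2 * Real.log (2 / δ) / (N : ℝ))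
  let A : ℕ → Set (Fin N → Z) := fun m =>
    {S | ∀ j : Fin (m + 1), gap Q l (τ j) S - gap Q l t₀ S ≤ b}
  have hAm : ∀ m, MeasurableSet (A m) := fun m => by
    have : A m = ⋂ j : Fin (m + 1), {S | gap Q l (τ j) S - gap Q l t₀ S ≤ b} := by
      ext S
      simp [A]
    rw [this]
    exact MeasurableSet.iInter fun j =>
      measurableSet_le ((measurable_gap hl _).sub (measurable_gap hl _)) measurable_const
  have hanti : Antitone A := fun m m' h S hS j =>
    hS ⟨j, j.2.trans_le (Nat.succ_le_succ h)⟩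
  have heq : {S : Fin N → Z | ∀ j, gap Q l (τ j) S - gap Q l t₀ S ≤ b} = ⋂ m, A m := by
    ext S
    simp only [Set.mem_ofPred_eq, Set.mem_iInter, A]
    exact ⟨fun h m j => h j, fun h j => h j ⟨j, Nat.lt_succ_self j⟩⟩
  rw [heq]
  -- The finite bounds do not depend on `m`, so they pass to the decreasing intersection.
  exact ge_of_tendsto' (tendsto_measure_iInter_atTop (fun m => (hAm m).nullMeasurableSet) hanti
    ⟨0, measure_ne_top _ _⟩) fun m => le_measure_uniform_gap_of_finite hN hl hBpos h0 hB
      (fun j : Fin (m + 1) => τ j) (hR m) t₀ hδ0 hδ1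

end Deviation

/-! ### Bounds and Lipschitz constant of the cross-entropy -/

section Loss

variable {D : ℕ}

lemma crossEntropyLoss_eq (z : Fin D → ℝ) (y : Fin D) :
    crossEntropyLoss z y = Real.log (1 + ∑ j ∈ Finset.univ.erase y, Real.exp (z j - z y)) := by
  have h : 1 + ∑ j ∈ Finset.univ.erase y, Real.exp (z j - z y) =
      (∑ j, Real.exp (z j)) / Real.exp (z y) := by
    rw [← Finset.add_sum_erase _ _ (Finset.mem_univ y), add_div, div_self (Real.exp_ne_zero _),
      Finset.sum_div]
    simp_rw [Real.exp_sub]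
  rw [h, crossEntropyLoss, softmax, ← Real.log_inv, inv_div]

lemma crossEntropyLoss_nonneg (z : Fin D → ℝ) (y : Fin D) : 0 ≤ crossEntropyLoss z y := by
  rw [crossEntropyLoss_eq]
  exact Real.log_nonneg (le_add_of_nonneg_right (Finset.sum_nonneg fun j _ => (Real.exp_pos _).le))

lemma sum_exp_sub_le {z : Fin D → ℝ} {r : ℝ} (hz : ∀ k, |z k| ≤ r) (y : Fin D) :
    ∑ j ∈ Finset.univ.erase y, Real.exp (z j - z y) ≤ ((D : ℝ) - 1) * Real.exp (2 * r) := by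
  have hD : 1 ≤ D := y.pos
  calc _ ≤ ∑ _j ∈ Finset.univ.erase y, Real.exp (2 * r) :=
        Finset.sum_le_sum fun j _ => Real.exp_le_exp.2 (by
          linarith [(abs_le.1 (hz j)).2, (abs_le.1 (hz y)).1])
    _ = _ := by simp [Finset.card_erase_of_mem, Nat.cast_sub hD]

lemma crossEntropyLoss_le {z : Fin D → ℝ} {r : ℝ} (hz : ∀ k, |z k| ≤ r) (y : Fin D) :
    crossEntropyLoss z y ≤ Real.log (1 + ((D : ℝ) - 1) * Real.exp (2 * r)) := by
  rw [crossEntropyLoss_eq]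
  refine Real.log_le_log ?_ (add_le_add_right (sum_exp_sub_le hz y) _)
  have : 0 ≤ ∑ j ∈ Finset.univ.erase y, Real.exp (z j - z y) :=
    Finset.sum_nonneg fun j _ => (Real.exp_pos _).le
  linarith

/-- The function `v ↦ log (1 + s * exp (-v))` is convex with slope `-s / (1 + s)` at zero, hence
lies above its tangent there. The proof uses convexity of `exp` with weights `1 / (1 + s)` and `s /
(1 + s)`. -/
lemma log_one_add_sub_le {s s' v : ℝ} (hs : 0 ≤ s) (h : s * Real.exp (-v) ≤ s') :
    Real.log (1 + s) - Real.log (1 + s') ≤ s / (1 + s) * v := by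
  have h1 : (0 : ℝ) < 1 + s := by linarith
  have hs' : 0 ≤ s' := (mul_nonneg hs (Real.exp_pos _).le).trans h
  have hconv := convexOn_exp.2 (Set.mem_univ 0) (Set.mem_univ (-v))
    (by positivity : (0 : ℝ) ≤ 1 / (1 + s)) (by positivity : (0 : ℝ) ≤ s / (1 + s))
    (by field_simp)
  simp only [smul_eq_mul, mul_zero, zero_add, Real.exp_zero, mul_one] at hconv
  have h2 : Real.exp (s / (1 + s) * -v) ≤ (1 + s') / (1 + s) := by
    refine hconv.trans ?_
    rw [div_mul_eq_mul_div, ← add_div]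
    gcongr
  have h3 : s / (1 + s) * -v ≤ Real.log ((1 + s') / (1 + s)) :=
    (Real.le_log_iff_exp_le (by positivity)).2 h2
  rw [Real.log_div (by positivity) h1.ne'] at h3
  linarith

lemma crossEntropyLoss_sub_le {z z' : Fin D → ℝ} {r : ℝ} (hz : ∀ k, |z k| ≤ r) (y : Fin D)
    {d : ℝ} (hd : ∀ k, |z k - z' k| ≤ d) :
    crossEntropyLoss z y - crossEntropyLoss z' y ≤
      2 * (((D : ℝ) - 1) / ((D : ℝ) - 1 + Real.exp (-2 * r))) * d := by
  have hd0 : 0 ≤ d := (abs_nonneg _).trans (hd y)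
  have hD : (0 : ℝ) ≤ (D : ℝ) - 1 := by
    have : (1 : ℝ) ≤ D := by exact_mod_cast y.pos
    linarith
  rw [crossEntropyLoss_eq, crossEntropyLoss_eq]
  set s := ∑ j ∈ Finset.univ.erase y, Real.exp (z j - z y)
  have hs : 0 ≤ s := Finset.sum_nonneg fun j _ => (Real.exp_pos _).le
  -- Each difference of two logits changes by at most `2 * d`; this is the source of the factor 2.
  have hs' : s * Real.exp (-(2 * d)) ≤
      ∑ j ∈ Finset.univ.erase y, Real.exp (z' j - z' y) := by
    rw [Finset.sum_mul]
    refine Finset.sum_le_sum fun j _ => ?_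
    rw [← Real.exp_add, Real.exp_le_exp]
    linarith [(abs_le.1 (hd j)).2, (abs_le.1 (hd y)).1]
  refine (log_one_add_sub_le hs hs').trans ?_
  have hq : s / (1 + s) ≤ ((D : ℝ) - 1) / ((D : ℝ) - 1 + Real.exp (-2 * r)) := by
    rw [div_le_div_iff₀ (by positivity) (by positivity)]
    have h1 := mul_le_mul_of_nonneg_right (sum_exp_sub_le hz y) (Real.exp_pos (-2 * r)).le
    rw [mul_assoc, ← Real.exp_add] at h1
    have : 2 * r + -2 * r = 0 := by ring
    rw [this, Real.exp_zero] at h1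
    nlinarith
  calc _ ≤ ((D : ℝ) - 1) / ((D : ℝ) - 1 + Real.exp (-2 * r)) * (2 * d) :=
        mul_le_mul_of_nonneg_right hq (by positivity)
    _ = _ := by ring

/-- On the cube `[-r, r]^D` the cross-entropy loss is Lipschitz for the sup norm. -/
lemma exists_abs_crossEntropyLoss_sub_le {z z' : Fin D → ℝ} {r : ℝ} (hz : ∀ k, |z k| ≤ r)
    (hz' : ∀ k, |z' k| ≤ r) (y : Fin D) :
    ∃ k, |crossEntropyLoss z y - crossEntropyLoss z' y| ≤
      2 * (((D : ℝ) - 1) / ((D : ℝ) - 1 + Real.exp (-2 * r))) * |z k - z' k| := by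
  obtain ⟨k, -, hk⟩ := Finset.exists_max_image Finset.univ (fun k => |z k - z' k|)
    ⟨y, Finset.mem_univ y⟩
  refine ⟨k, abs_sub_le_iff.2 ⟨?_, ?_⟩⟩
  · exact crossEntropyLoss_sub_le hz y fun j => hk j (Finset.mem_univ j)
  · exact crossEntropyLoss_sub_le hz' y fun j => by
      rw [abs_sub_comm]
      exact hk j (Finset.mem_univ j)

lemma continuous_crossEntropyLoss (y : Fin D) :
    Continuous fun z : Fin D → ℝ => crossEntropyLoss z y := by
  simp_rw [crossEntropyLoss_eq]
  refine Continuous.log (by fun_prop) fun z => ?_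
  have : 0 ≤ ∑ j ∈ Finset.univ.erase y, Real.exp (z j - z y) :=
    Finset.sum_nonneg fun j _ => (Real.exp_pos _).le
  linarith

end Loss

/-! ### Diversity bounds the logits -/

section NetworkBounds

variable {p M D : ℕ} {ρ : ℝ → ℝ} {L : ℝ≥0} {C₁ C₃ C₄ dmin : ℝ}

lemma sum_sq_sub_offDiag (φ : Fin M → ℝ) :
    ∑ i : Fin M, ∑ j ∈ Finset.univ.filter (fun j : Fin M => i ≠ j), (φ i - φ j) ^ 2 =
      2 * (M * ∑ i, φ i ^ 2 - (∑ i, φ i) ^ 2) := by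
  have h : ∀ i : Fin M, ∑ j ∈ Finset.univ.filter (fun j : Fin M => i ≠ j), (φ i - φ j) ^ 2 =
      ∑ j, (φ i - φ j) ^ 2 := fun i => by
    rw [Finset.sum_filter]
    refine Finset.sum_congr rfl fun j _ => ?_
    split_ifs with hij
    · rfl
    · rw [not_not.1 hij]
      ring
  simp_rw [h, sub_sq, Finset.sum_add_distrib, Finset.sum_sub_distrib, mul_assoc,
    ← Finset.mul_sum, ← Finset.sum_mul]
  simp only [Finset.sum_const, Finset.card_univ, Fintype.card_fin, nsmul_eq_mul]
  rw [← Finset.mul_sum]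
  ring

/-- Diversity is `(M * ∑ φ² - (∑ φ)²) / (M * (M - 1))`, so a lower bound on it pushes `(∑ φ)²` below
`M * ∑ φ² ≤ M² * C²`. -/
lemma sq_sum_le_of_le_diversity (hM : 2 ≤ M) {φ : Fin M → ℝ} {C d : ℝ} (h0 : ∀ m, 0 ≤ φ m)
    (hC : ∀ m, φ m ≤ C) (hd : d ≤ diversity φ) :
    (∑ m, φ m) ^ 2 ≤ M * C ^ 2 + M * ((M : ℝ) - 1) * (C ^ 2 - d) := by
  have hM' : (2 : ℝ) ≤ M := by exact_mod_cast hM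
  have hpos : (0 : ℝ) < M * ((M : ℝ) - 1) := mul_pos (by linarith) (by linarith)
  rw [diversity, sum_sq_sub_offDiag] at hd
  have h1 : d * (M * ((M : ℝ) - 1)) ≤ M * ∑ i, φ i ^ 2 - (∑ i, φ i) ^ 2 := by
    rw [← le_div_iff₀ hpos]
    refine hd.trans (le_of_eq ?_)
    rw [mul_assoc, one_div, mul_inv]
    field_simp
  have h2 : ∑ i, φ i ^ 2 ≤ M * C ^ 2 := by
    calc _ ≤ ∑ _i : Fin M, C ^ 2 :=
          Finset.sum_le_sum fun i _ => pow_le_pow_left₀ (h0 i) (hC i) 2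
      _ = _ := by simp
  have h3 := mul_le_mul_of_nonneg_left h2 (by linarith : (0 : ℝ) ≤ M)
  nlinarith

lemma features_le_const5 (hρ : LipschitzWith L ρ) (hC₃ : 0 ≤ C₃)
    {W : Fin M → EuclideanSpace ℝ (Fin p)} (hW : ∀ m, ‖W m‖ ≤ C₃)
    {x : EuclideanSpace ℝ (Fin p)} (hx : ‖x‖ ≤ C₁) (m : Fin M) :
    features ρ W x m ≤ const5 ρ L C₁ C₃ := by
  have h1 := hρ.dist_le_mul (inner ℝ (W m) x) 0
  rw [Real.dist_eq, Real.dist_eq, sub_zero] at h1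
  have h2 : |inner ℝ (W m) x| ≤ C₃ * C₁ := (abs_real_inner_le_norm _ _).trans
    (mul_le_mul (hW m) hx (norm_nonneg _) hC₃)
  have h3 := mul_le_mul_of_nonneg_left h2 L.coe_nonneg
  have h4 := le_abs_self (ρ (inner ℝ (W m) x) - ρ 0)
  unfold features const5
  linarith

lemma abs_network_le (hM : 2 ≤ M) (hρ : LipschitzWith L ρ) (hρ0 : ∀ t, 0 ≤ ρ t)
    (hC₃ : 0 ≤ C₃) {W : Fin M → EuclideanSpace ℝ (Fin p)} (hW : ∀ m, ‖W m‖ ≤ C₃)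
    {V : Fin D → Fin M → ℝ} (hV : ∀ k, ‖V k‖ ≤ C₄) {x : EuclideanSpace ℝ (Fin p)}
    (hx : ‖x‖ ≤ C₁) (hd : dmin ^ 2 ≤ diversity (features ρ W x)) (k : Fin D) :
    |network ρ W V x k| ≤ √(constJ ρ L C₁ C₃ C₄ dmin M) := by
  apply Real.abs_le_sqrt
  have h0 : ∀ m, 0 ≤ features ρ W x m := fun m => hρ0 _
  have h1 : |network ρ W V x k| ≤ C₄ * ∑ m, features ρ W x m := by
    rw [Finset.mul_sum]
    refine (Finset.abs_sum_le_sum_abs _ _).trans (Finset.sum_le_sum fun m _ => ?_)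
    rw [abs_mul, abs_of_nonneg (h0 m)]
    exact mul_le_mul_of_nonneg_right ((norm_le_pi_norm (V k) m).trans (hV k)) (h0 m)
  have h2 := sq_sum_le_of_le_diversity hM h0 (features_le_const5 hρ hC₃ hW hx) hd
  calc network ρ W V x k ^ 2 = |network ρ W V x k| ^ 2 := (sq_abs _).symm
    _ ≤ (C₄ * ∑ m, features ρ W x m) ^ 2 := pow_le_pow_left₀ (abs_nonneg _) h1 2
    _ = C₄ ^ 2 * (∑ m, features ρ W x m) ^ 2 := mul_pow _ _ _
    _ ≤ _ := mul_le_mul_of_nonneg_left h2 (sq_nonneg _)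

lemma continuous_network (hρ : Continuous ρ) (W : Fin M → EuclideanSpace ℝ (Fin p))
    (V : Fin D → Fin M → ℝ) : Continuous (network ρ W V) := by
  unfold network features
  fun_prop

lemma continuous_network_param (hρ : Continuous ρ) (x : EuclideanSpace ℝ (Fin p)) :
    Continuous fun q : (Fin M → EuclideanSpace ℝ (Fin p)) × (Fin D → Fin M → ℝ) =>
      network ρ q.1 q.2 x := by
  unfold network features
  fun_prop

lemma measurable_loss_network (hρ : Continuous ρ) (W : Fin M → EuclideanSpace ℝ (Fin p))
    (V : Fin D → Fin M → ℝ) :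
    Measurable fun z : EuclideanSpace ℝ (Fin p) × Fin D =>
      crossEntropyLoss (network ρ W V z.1) z.2 :=
  measurable_from_prod_countable_left fun y =>
    ((continuous_crossEntropyLoss y).comp (continuous_network hρ W V)).measurable

end NetworkBounds

/-! ### Passage to the full class and the main theorem -/

/-- The weights of the networks in `hypothesisClass`. -/
def parameterSet {p : ℕ} (M D : ℕ) (ρ : ℝ → ℝ) (𝒳 : Set (EuclideanSpace ℝ (Fin p)))
    (C₃ C₄ dmin : ℝ) : Set ((Fin M → EuclideanSpace ℝ (Fin p)) × (Fin D → Fin M → ℝ)) :=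
  {q | (∀ m, ‖q.1 m‖ ≤ C₃) ∧ (∀ k, ‖q.2 k‖ ≤ C₄) ∧
    ∀ x ∈ 𝒳, dmin ^ 2 ≤ diversity (features ρ q.1 x)}

lemma crossEntropyLoss_one (z : Fin 1 → ℝ) (y : Fin 1) : crossEntropyLoss z y = 0 := by
  rw [crossEntropyLoss_eq, Subsingleton.elim y 0]
  simp

end DiverseNet

theorem mainTheorem6 (p M D N : ℕ) (hM : 2 ≤ M) (hN : 1 ≤ N)
    (ρ : ℝ → ℝ) (Lρ : ℝ≥0) (hρ : LipschitzWith Lρ ρ) (hρ0 : ∀ t, 0 ≤ ρ t)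
    (C₁ C₃ C₄ dmin : ℝ)
    (𝒳 : Set (EuclideanSpace ℝ (Fin p))) (h𝒳 : ∀ x ∈ 𝒳, ‖x‖ ≤ C₁)
    (Q : Measure (EuclideanSpace ℝ (Fin p) × Fin D)) [IsProbabilityMeasure Q]
    (hQ : ∀ᵐ z ∂Q, z.1 ∈ 𝒳)
    (fstar : EuclideanSpace ℝ (Fin p) → Fin D → ℝ)
    (hfstar : DiverseNet.IsMinimizer (DiverseNet.risk Q)
      (DiverseNet.hypothesisClass M D ρ 𝒳 C₃ C₄ dmin) fstar)
    (δ : ℝ) (hδ0 : 0 < δ) (hδ1 : δ < 1) :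
    ∃ G : Set (Fin N → EuclideanSpace ℝ (Fin p) × Fin D),
      MeasurableSet G ∧
      ENNReal.ofReal (1 - δ) ≤ Measure.pi (fun _ : Fin N => Q) G ∧
      ∀ S ∈ G, ∀ fhat : EuclideanSpace ℝ (Fin p) → Fin D → ℝ,
        DiverseNet.IsMinimizer (DiverseNet.empiricalRisk S)
          (DiverseNet.hypothesisClass M D ρ 𝒳 C₃ C₄ dmin) fhat →
        DiverseNet.risk Q fhat - DiverseNet.risk Q fstar ≤
          DiverseNet.constA ρ Lρ C₁ C₃ C₄ M D /
              (((D : ℝ) - 1 +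
                  Real.exp (-2 * √(DiverseNet.constJ ρ Lρ C₁ C₃ C₄ dmin M))) * √(N : ℝ)) +
            Real.log (1 + ((D : ℝ) - 1) *
                Real.exp (2 * √(DiverseNet.constJ ρ Lρ C₁ C₃ C₄ dmin M))) *
              √(2 * Real.log (2 / δ) / (N : ℝ)) := by
  classical
  obtain ⟨E, hEae, hEm, hE𝒳⟩ := hQ.exists_measurable_mem
  obtain ⟨z₀, hz₀⟩ := (show ∀ᵐ z ∂Q, z ∈ E from hEae).exists
  have hN' : (0 : ℝ) < N := by exact_mod_cast hN
  have hlog : 0 < Real.log (2 / δ) := Real.log_pos (by rw [lt_div_iff₀ hδ0]; linarith)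
  set r := √(DiverseNet.constJ ρ Lρ C₁ C₃ C₄ dmin M) with hr
  -- For a single class the loss vanishes, and so does the bound on it, whereas the deviation
  -- theorem needs `B` positive.
  rcases (Nat.succ_le_of_lt z₀.2.pos).eq_or_lt with hD1 | hD2
  · obtain rfl : D = 1 := hD1.symm
    refine ⟨Set.univ, MeasurableSet.univ, ?_, fun S _ fhat _ => ?_⟩
    · rw [measure_univ]
      exact ENNReal.ofReal_le_one.2 (by linarith)
    · simp [DiverseNet.risk, DiverseNet.crossEntropyLoss_one, DiverseNet.constA]
  have hD2' : (2 : ℝ) ≤ D := by exact_mod_cast hD2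
  obtain ⟨⟨W₀, V₀, hW₀, hV₀, hd₀, rfl⟩, -⟩ := hfstar
  have hC₁ : 0 ≤ C₁ := (norm_nonneg _).trans (h𝒳 _ (hE𝒳 z₀ hz₀))
  have hC₃ : 0 ≤ C₃ := (norm_nonneg _).trans (hW₀ ⟨0, by omega⟩)
  let P := DiverseNet.parameterSet M D ρ 𝒳 C₃ C₄ dmin
  let t₀ : P := ⟨(W₀, V₀), hW₀, hV₀, hd₀⟩
  have : Nonempty P := ⟨t₀⟩
  -- Points outside the full-measure set `E` are sent to `z₀`, so that the bounds on the loss hold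
  -- everywhere and not just almost everywhere; risks are unchanged.
  let π : EuclideanSpace ℝ (Fin p) × Fin D → EuclideanSpace ℝ (Fin p) × Fin D :=
    fun z => if z ∈ E then z else z₀
  have hπm : Measurable π := Measurable.ite hEm measurable_id measurable_const
  have hπE : ∀ z, π z ∈ E := fun z => by
    by_cases h : z ∈ E <;> simp [π, h, hz₀]
  have hπ : ∀ z ∈ E, π z = z := fun z h => by simp [π, h]
  have hπ𝒳 : ∀ z, (π z).1 ∈ 𝒳 := fun z => hE𝒳 _ (hπE z)
  let net : P → EuclideanSpace ℝ (Fin p) → Fin D → ℝ :=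
    fun t => DiverseNet.network ρ t.1.1 t.1.2
  let l : P → EuclideanSpace ℝ (Fin p) × Fin D → ℝ :=
    fun t z => DiverseNet.crossEntropyLoss (net t (π z).1) (π z).2
  set B := Real.log (1 + ((D : ℝ) - 1) * Real.exp (2 * r))
  have hBpos : 0 < B := Real.log_pos (lt_add_of_pos_right _
    (mul_pos (by linarith) (Real.exp_pos _)))
  have hnet : ∀ t z k, |net t (π z).1 k| ≤ r := fun t z k =>
    DiverseNet.abs_network_le hM hρ hρ0 hC₃ t.2.1 t.2.2.1 (h𝒳 _ (hπ𝒳 z))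
      (t.2.2.2 _ (hπ𝒳 z)) k
  have hlm : ∀ t, Measurable (l t) := fun t =>
    (DiverseNet.measurable_loss_network hρ.continuous t.1.1 t.1.2).comp hπm
  have hl0 : ∀ t z, 0 ≤ l t z := fun t z => DiverseNet.crossEntropyLoss_nonneg _ _
  have hlB : ∀ t z, l t z ≤ B := fun t z => DiverseNet.crossEntropyLoss_le (hnet t z) _
  have hlc : ∀ z, Continuous fun t => l t z := fun z =>
    (DiverseNet.continuous_crossEntropyLoss (π z).2).comp
      ((DiverseNet.continuous_network_param hρ.continuous (π z).1).comp continuous_subtype_val)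
  set κ := ((D : ℝ) - 1) / ((D : ℝ) - 1 + Real.exp (-2 * r))
  have hden : 0 < (D : ℝ) - 1 + Real.exp (-2 * r) := add_pos (by linarith) (Real.exp_pos _)
  have hκ : 0 ≤ 2 * κ := mul_nonneg zero_le_two (div_nonneg (by linarith) hden.le)
  set R := 2 * κ * (D * (M * (C₄ * ((2 * Lρ * (C₁ * C₃) + |ρ 0|) * √(N : ℝ))))) with hR
  have hRad : ∀ (m : ℕ) (S : Fin N → EuclideanSpace ℝ (Fin p) × Fin D),
      Finset.univ.expect (fun s : Fin N → Bool => DiverseNet.maxOver fun j : Fin (m + 1) =>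
        ∑ i, DiverseNet.sgn (s i) * l (TopologicalSpace.denseSeq P j) (S i)) ≤ R := by
    intro m S
    set τ : Fin (m + 1) → P := fun j => TopologicalSpace.denseSeq P j
    have h1 := DiverseNet.contraction (K := Fin D) (fun _ : Fin (m + 1) => 0)
      (fun i j => l (τ j) (S i)) (fun i k j => 2 * κ * net (τ j) (π (S i)).1 k)
      fun i j j' => by
        obtain ⟨k, hk⟩ := DiverseNet.exists_abs_crossEntropyLoss_sub_le
          (hnet (τ j) (S i)) (hnet (τ j') (S i)) (π (S i)).2
        refine ⟨k, ?_⟩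
        rwa [← mul_sub, abs_mul, abs_of_nonneg hκ]
    simp only [zero_add] at h1
    exact h1.trans (DiverseNet.expect_maxOver_network_le hC₁ hC₃ hρ (fun j => (τ j).1.1)
      (fun j => (τ j).2.1) (fun j => (τ j).1.2) (fun j => (τ j).2.2.1)
      (fun i => (π (S i)).1) (fun i => h𝒳 _ (hπ𝒳 (S i))) hκ)
  have hmain := DiverseNet.le_measure_uniform_gap (Q := Q) hN hlm hBpos hl0 hlB
    (TopologicalSpace.denseSeq P) hRad t₀ hδ0 hδ1
  set b := 2 * R / N + B * √(2 * Real.log (2 / δ) / (N : ℝ)) with hb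
  set A := {S : Fin N → EuclideanSpace ℝ (Fin p) × Fin D |
    ∀ j, DiverseNet.gap Q l (TopologicalSpace.denseSeq P j) S - DiverseNet.gap Q l t₀ S ≤ b}
  have hAm : MeasurableSet A := by
    have : A = ⋂ j, {S | DiverseNet.gap Q l (TopologicalSpace.denseSeq P j) S -
        DiverseNet.gap Q l t₀ S ≤ b} := by
      ext S
      simp [A]
    rw [this]
    exact MeasurableSet.iInter fun j => measurableSet_le
      ((DiverseNet.measurable_gap hlm _).sub (DiverseNet.measurable_gap hlm _)) measurable_const
  have hrisk : ∀ t : P, DiverseNet.risk Q (net t) = ∫ z, l t z ∂Q := fun t => by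
    refine integral_congr_ae ?_
    filter_upwards [hEae] with z hz
    simp only [l, hπ z hz]
  -- On samples inside `E` the modified empirical risk is the true one, and almost every sample lies
  -- there.
  refine ⟨A ∩ {S | ∀ i, S i ∈ E}, hAm.inter ?_, ?_, ?_⟩
  · have : {S : Fin N → EuclideanSpace ℝ (Fin p) × Fin D | ∀ i, S i ∈ E} =
        ⋂ i, Function.eval i ⁻¹' E := by
      ext S
      simp
    rw [this]
    exact MeasurableSet.iInter fun i => measurable_pi_apply i hEm
  · refine hmain.trans (measure_mono_ae ?_)
    have hae : ∀ᵐ S ∂(Measure.pi fun _ : Fin N => Q), ∀ i, S i ∈ E :=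
      ae_all_iff.2 fun i =>
        (measurePreserving_eval (fun _ : Fin N => Q) i).quasiMeasurePreserving.ae hEae
    filter_upwards [hae] with S hS hSA
    exact ⟨hSA, hS⟩
  · rintro S ⟨hSA, hSE⟩ fhat ⟨⟨W, V, hW, hV, hd, rfl⟩, hmin⟩
    let t : P := ⟨(W, V), hW, hV, hd⟩
    -- Dominated convergence makes the gap continuous in the weights, so the bound on the dense
    -- sequence extends to every parameter, in particular to the sample-dependent `fhat`.
    have hcint : Continuous fun t => ∫ z, l t z ∂Q :=
      continuous_of_dominated (bound := fun _ => B) (fun t => (hlm t).aestronglyMeasurable)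
        (fun t => Filter.Eventually.of_forall fun z => by
          rw [Real.norm_eq_abs, abs_of_nonneg (hl0 t z)]
          exact hlB t z)
        (integrable_const _) (Filter.Eventually.of_forall hlc)
    have hcgap : Continuous fun t => DiverseNet.gap Q l t S :=
      hcint.sub (continuous_const.mul (continuous_finsetSum _ fun i _ => hlc (S i)))
    have hclosed : IsClosed {t | DiverseNet.gap Q l t S - DiverseNet.gap Q l t₀ S ≤ b} :=
      isClosed_le (hcgap.sub continuous_const) continuous_const
    have hall : ∀ t, DiverseNet.gap Q l t S - DiverseNet.gap Q l t₀ S ≤ b := fun t => by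
      have hsub : Set.range (TopologicalSpace.denseSeq P) ⊆
          {t | DiverseNet.gap Q l t S - DiverseNet.gap Q l t₀ S ≤ b} := by
        rintro _ ⟨j, rfl⟩
        exact hSA j
      exact closure_minimal hsub hclosed (TopologicalSpace.denseRange_denseSeq P t)
    have hemp : ∀ t : P, DiverseNet.empiricalRisk S (net t) = 1 / (N : ℝ) * ∑ i, l t (S i) :=
      fun t => by
        unfold DiverseNet.empiricalRisk
        congr 1
        exact Finset.sum_congr rfl fun i _ => by simp only [l, hπ _ (hSE i)]
    have h1 := hall t
    have h2 : DiverseNet.empiricalRisk S (net t) ≤ DiverseNet.empiricalRisk S (net t₀) :=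
      hmin _ ⟨W₀, V₀, hW₀, hV₀, hd₀, rfl⟩
    rw [hemp, hemp] at h2
    have h3 : 2 * R / N = DiverseNet.constA ρ Lρ C₁ C₃ C₄ M D /
        (((D : ℝ) - 1 + Real.exp (-2 * r)) * √(N : ℝ)) := by
      have hs : √(N : ℝ) * √(N : ℝ) = N := Real.mul_self_sqrt hN'.le
      have hs0 : 0 < √(N : ℝ) := Real.sqrt_pos.2 hN'
      rw [div_eq_div_iff hN'.ne' (mul_pos hden hs0).ne']
      have hκd : κ * ((D : ℝ) - 1 + Real.exp (-2 * r)) = (D : ℝ) - 1 :=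
        div_mul_cancel₀ _ hden.ne'
      rw [hR, DiverseNet.constA]
      calc _ = 4 * (κ * ((D : ℝ) - 1 + Real.exp (-2 * r))) * (D * (M * (C₄ *
            (2 * Lρ * (C₁ * C₃) + |ρ 0|)))) * (√(N : ℝ) * √(N : ℝ)) := by ring
        _ = _ := by
          rw [hκd, hs]
          ring
    have h4 : DiverseNet.risk Q (net t) - DiverseNet.risk Q (net t₀) ≤ b := by
      rw [hrisk, hrisk]
      simp only [DiverseNet.gap] at h1
      linarith
    rw [← h3]
    exact h4
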